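/- Let $q=e^{2\pi i\tau}$ with $\operatorname{Im}\tau>0$, let $\eta(\tau)=q^{1/24}\prod_{n\ge1}(1-q^n)$ be the Dedekind eta function, and put \[ \Phi_2(q)=\frac{\eta(2\tau)}{\eta(\tau)^2}=\prod_{n\ge1}\frac{1-q^{2n}}{(1-q^n)^2},\qquad G_2(q)=\left(\frac{\eta(2\tau)}{\eta(\tau)}\right)^{24}=q\prod_{n\ge1}\left(\frac{1-q^{2n}}{1-q^n}\right)^{24}, \] regarded as power series in $q$ with integer coefficients. Let $U_2$ be Atkin's operator, $\left(\sum_{n\ge0}a(n)q^n\right)\big|\,U_2=\sum_{n\ge0}a(2n)q^n$. For an integer $s\ge1$ define power series $L_m^s$ ($m\ge1$) by \[ L_1^s=\left(\Phi_2(-q)\,G_2(-q)^s\right)\big|\,U_2,\qquad L_m^s=L_{m-1}^s\,\big|\,U_2\quad(m\ge2). \] Then for all integers $s\ge1$ and $\alpha\ge1$, \[ L_{2\alpha-1}^s\equiv0\pmod{2^{2\alpha-s}},\qquad L_{2\alpha}^s\equiv0\pmod{2^{2\alpha-s+1}}. \] Here a power series with integer coefficients is said to be $\equiv0\pmod{2^e}$,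 where $e\in\mathbb{Z}$, if each of its coefficients is an integer multiple of $2^e$; for $e\le0$ this is no condition. -/

import Mathlib

namespace OverpartitionU2

open scoped PowerSeries

noncomputable section

section EtaProd

open scoped PowerSeries.WithPiTopology

/-- The infinite product `∏_{n ≥ 1} (1 - q ^ (d n))` in `ℤ⟦q⟧` (coefficientwise limit).
With `q = exp (2 π i τ)`, the Dedekind eta function is `η(d τ) = q ^ (d / 24) * etaProd d`. -/
def etaProd (d : ℕ) : ℤ⟦X⟧ :=
  ∏' n : ℕ, (1 - (PowerSeries.X : ℤ⟦X⟧) ^ (d * (n + 1)))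

/-- For `d ≥ 1` the product defining `etaProd d` converges. -/
theorem multipliable_etaProd {d : ℕ} (hd : 1 ≤ d) :
    Multipliable fun n : ℕ ↦ (1 - (PowerSeries.X : ℤ⟦X⟧) ^ (d * (n + 1))) := by
  simp_rw [sub_eq_add_neg]
  apply PowerSeries.WithPiTopology.multipliable_one_add_of_tendsto_order_atTop_nhds_top
  refine ENat.tendsto_nhds_top_iff_natCast_lt.mpr fun n ↦ Filter.eventually_atTop.mpr ⟨n, ?_⟩
  intro m hm
  rw [PowerSeries.order_neg, PowerSeries.order_X_pow]
  norm_cast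
  nlinarith

theorem constantCoeff_etaProd {d : ℕ} (hd : 1 ≤ d) :
    PowerSeries.constantCoeff (etaProd d) = 1 := by
  have hd0 : d ≠ 0 := by omega
  unfold etaProd
  rw [(multipliable_etaProd hd).map_tprod _
    (PowerSeries.WithPiTopology.continuous_constantCoeff ℤ)]
  simp [hd0]

end EtaProd

/-- The inverse of `etaProd d` in `ℤ⟦q⟧` (the constant coefficient is `1`). -/
def etaProdInv (d : ℕ) : ℤ⟦X⟧ :=
  PowerSeries.invOfUnit (etaProd d) 1

theorem etaProd_mul_etaProdInv {d : ℕ} (hd : 1 ≤ d) : etaProd d * etaProdInv d = 1 :=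
  PowerSeries.mul_invOfUnit _ _ (by simp [constantCoeff_etaProd hd])

/-- `Φ₂(q) = η(2τ) / η(τ)²`; the powers of `q ^ (1 / 24)` cancel, as `2 - 2 * 1 = 0`. -/
def Phi2 : ℤ⟦X⟧ :=
  etaProd 2 * etaProdInv 1 ^ 2

/-- `G₂(q) = (η(2τ) / η(τ))²⁴`; the powers of `q ^ (1 / 24)` combine to
`q ^ (24 * (2 - 1) / 24) = q`. -/
def G2 : ℤ⟦X⟧ :=
  PowerSeries.X * (etaProd 2 * etaProdInv 1) ^ 24

/-- Atkin's operator `U₂ : ∑ a(n) q ^ n ↦ ∑ a(2n) q ^ n`. -/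
def U2 (f : ℤ⟦X⟧) : ℤ⟦X⟧ :=
  PowerSeries.mk fun n ↦ PowerSeries.coeff (2 * n) f

/-- The iterates: `L s 0 = Φ₂(-q) G₂(-q) ^ s` and `L s (α + 1) = L s α | U₂`, so that
`L s 1 = Φ₂(-q) G₂(-q) ^ s | U₂`. -/
def L (s : ℕ) : ℕ → ℤ⟦X⟧
  | 0 => PowerSeries.evalNegHom Phi2 * PowerSeries.evalNegHom G2 ^ s
  | α + 1 => U2 (L s α)

/-- `f ≡ 0 (mod 2 ^ e)` for an integer exponent `e`: every coefficient of `f` is an integer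
multiple of the rational number `2 ^ e` (no condition when `e ≤ 0`). -/
def ZeroModTwoPow (f : ℤ⟦X⟧) (e : ℤ) : Prop :=
  ∀ n : ℕ, ∃ m : ℤ, ((PowerSeries.coeff n f : ℤ) : ℚ) = (m : ℚ) * (2 : ℚ) ^ e

end

end OverpartitionU2

namespace OverpartitionU2

open PowerSeries Filter Topology
open scoped PowerSeries.WithPiTopology

/-! Write φ = `thetaSq`, ψ = `thetaTri`. Gauss's product formulas turn the eta quotients into theta
quotients: Φ₂(-q) = 1/φ(q) and G₂(-q) = -t(1 - 16t), where t = qψ(q²)⁴/φ(q)⁴ (`evalNegHom_G2`).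
Hence 2^s Φ₂(-q) G₂(-q)^s is 1/φ(q) times an integral series in 2t without constant term.

Let v = qψ(q⁸)/φ(q⁴) and w = qψ(q⁴)²/φ(q²)². Then φ(q) = (1 + 2v)φ(q⁴) and t(1 + 2v)⁴ = v(1 + 4v²),
so a series in 2t over φ(q) is a series in 2v over φ(q⁴) (`exists_recipTheta_mul_subst`). Both v and
w are odd, with v² = w(q²) and w² = t(q²). So one U₂ leads to a series in 4w over φ(q²), and the
next to a series in 16t over φ(q). Since 16t = 8 · 2t and the constant term is zero, each pair of
steps gains a factor 8. Induction gives 2^(3α+1) ∣ 2^s L_{2α} and 2^(3α+2) ∣ 2^s L_{2α+1}, which is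
more than is needed. -/

/-! ### Finite forms of two identities of Gauss -/

section Finite

variable {R : Type*} [CommRing R] (q : R)

/-- The summand in the finite form of `∑ (-1)ⁿ q ^ n²`, for index `s + 1`. -/
def squareTerm (n s : ℕ) : R :=
  (-1) ^ (s + 1) * q ^ ((s + 1) * (n + 1)) * (∏ k ∈ Finset.range s, (1 + q ^ (k + 1))) *
    ∏ k ∈ Finset.Ico (s + 1) n, (1 - q ^ (k + 1))

/-- Telescoping in `m`; the case `m = n` is the induction step of the finite Gauss identity. -/
theorem sum_squareTerm_succ_sub (n m : ℕ) (hm : m ≤ n) :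
    ∏ k ∈ Finset.range (n + 1), (1 - q ^ (k + 1))
      - (1 + q ^ (n + 1)) * ∏ k ∈ Finset.range n, (1 - q ^ (k + 1))
      + 2 * ∑ s ∈ Finset.range m,
        (squareTerm q (n + 1) s - (1 + q ^ (n + 1)) * squareTerm q n s) =
    2 * (-1) ^ (m + 1) * q ^ ((m + 1) * (n + 1)) * (∏ k ∈ Finset.range m, (1 + q ^ (k + 1))) *
      ∏ k ∈ Finset.Ico m n, (1 - q ^ (k + 1)) := by
  induction m with
  | zero => simp [Finset.prod_range_succ]; ring
  | succ m ih =>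
    rw [Finset.sum_range_succ, mul_add, ← add_assoc, ih (by omega),
      Finset.prod_eq_prod_Ico_succ_bot (show m < n by omega)]
    simp only [squareTerm, Finset.prod_range_succ]
    rw [Finset.prod_Ico_succ_top (show m + 1 ≤ n by omega)]
    ring

/-- Each `squareTerm q n s` is divisible by `q ^ (n + 1)`, so only the product on the right survives
as `n → ∞`. -/
theorem prod_mul_sum_neg_one_pow_sq (n : ℕ) :
    (∏ k ∈ Finset.range n, (1 + q ^ (k + 1))) *
      (1 + 2 * ∑ s ∈ Finset.range n, (-1) ^ (s + 1) * q ^ (s + 1) ^ 2) =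
    ∏ k ∈ Finset.range n, (1 - q ^ (k + 1)) + 2 * ∑ s ∈ Finset.range n, squareTerm q n s := by
  induction n with
  | zero => simp
  | succ n ih =>
    have h := sum_squareTerm_succ_sub q n n le_rfl
    rw [Finset.sum_sub_distrib, ← Finset.mul_sum] at h
    rw [Finset.sum_range_succ, Finset.sum_range_succ _ n, Finset.prod_range_succ]
    have h2 : squareTerm q (n + 1) n = (-1) ^ (n + 1) * q ^ ((n + 1) * (n + 1 + 1)) *
      (∏ k ∈ Finset.range n, (1 + q ^ (k + 1))) := by simp [squareTerm]
    rw [h2]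
    simp only [Finset.Ico_self, Finset.prod_empty, mul_one] at h
    linear_combination (1 + q ^ (n + 1)) * ih - h

/-- The summand in the finite form of `∑ q ^ (n (n + 1) / 2)`. -/
def triangleTerm (n s : ℕ) : R :=
  q ^ (s * (2 * n + 1)) * (∏ k ∈ Finset.range s, (1 - q ^ (2 * k + 1))) *
    ∏ k ∈ Finset.Ico s n, (1 - q ^ (2 * k + 2))

theorem sum_triangleTerm_succ_sub (n m : ℕ) (hm : m ≤ n) :
    ∑ s ∈ Finset.range m,
        (triangleTerm q (n + 1) s - (1 - q ^ (2 * n + 1)) * triangleTerm q n s) =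
      triangleTerm q n m * (1 - q ^ (2 * m)) := by
  induction m with
  | zero => simp
  | succ m ih =>
    rw [Finset.sum_range_succ, ih (by omega)]
    simp only [triangleTerm, Finset.prod_range_succ]
    rw [Finset.prod_Ico_succ_top (show m ≤ n by omega),
      Finset.prod_eq_prod_Ico_succ_bot (show m < n by omega)]
    ring

/-- Only the term `s = 0` on the right survives as `n → ∞`, the others being divisible by `q ^ (2 *
n + 1)`. -/
theorem prod_mul_sum_triangle (n : ℕ) :
    (∏ k ∈ Finset.range n, (1 - q ^ (2 * k + 1))) *
      ∑ s ∈ Finset.range (2 * n + 1), q ^ (s * (s + 1) / 2) =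
    ∑ s ∈ Finset.range (n + 1), triangleTerm q n s := by
  induction n with
  | zero => simp [triangleTerm]
  | succ n ih =>
    have h := sum_triangleTerm_succ_sub q n n le_rfl
    rw [Finset.sum_sub_distrib, ← Finset.mul_sum] at h
    rw [Finset.sum_range_succ _ (2 * n), Finset.sum_range_succ _ n] at ih
    rw [show 2 * (n + 1) + 1 = 2 * n + 1 + 1 + 1 by ring, Finset.sum_range_succ _ (2 * n + 1 + 1),
      Finset.sum_range_succ _ (2 * n + 1), Finset.sum_range_succ _ (n + 1),
      Finset.sum_range_succ _ n, Finset.prod_range_succ, Finset.sum_range_succ _ (2 * n),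
      show (2 * n + 1) * (2 * n + 1 + 1) / 2 = (2 * n + 1) * (n + 1) by
        rw [show (2 * n + 1) * (2 * n + 1 + 1) = (2 * n + 1) * (n + 1) * 2 by ring]; simp,
      show (2 * n + 1 + 1) * (2 * n + 1 + 1 + 1) / 2 = (n + 1) * (2 * n + 3) by
        rw [show (2 * n + 1 + 1) * (2 * n + 1 + 1 + 1) = (n + 1) * (2 * n + 3) * 2 by ring]; simp]
    simp only [triangleTerm, Finset.Ico_self, Finset.prod_empty, Finset.prod_range_succ,
      Nat.Ico_succ_singleton, Finset.prod_singleton] at h ih ⊢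
    linear_combination (1 - q ^ (2 * n + 1)) * ih - h

theorem prod_one_sub_mul_prod_one_sub_neg (n : ℕ) :
    (∏ k ∈ Finset.range (2 * n), (1 - q ^ (k + 1))) *
      (∏ k ∈ Finset.range (2 * n), (1 - (-q) ^ (k + 1))) *
      (∏ k ∈ Finset.range n, (1 - q ^ (4 * (k + 1)))) =
    (∏ k ∈ Finset.range n, (1 - q ^ (2 * (k + 1)))) ^ 2 *
      ∏ k ∈ Finset.range (2 * n), (1 - q ^ (2 * (k + 1))) := by
  induction n with
  | zero => simp
  | succ n ih =>
    rw [show 2 * (n + 1) = 2 * n + 1 + 1 by ring]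
    simp only [Finset.prod_range_succ]
    have h1 : (-q) ^ (2 * n + 1) = - q ^ (2 * n + 1) := Odd.neg_pow ⟨n, rfl⟩ q
    have h2 : (-q) ^ (2 * n + 1 + 1) = q ^ (2 * n + 1 + 1) := Even.neg_pow ⟨n + 1, by ring⟩ q
    rw [h1, h2]
    linear_combination (1 - q ^ (2 * n + 1)) * (1 + q ^ (2 * n + 1)) *
      (1 - q ^ (2 * n + 2)) ^ 2 * (1 - q ^ (4 * (n + 1))) * ih

theorem prod_one_sub_odd_mul_even (n : ℕ) :
    (∏ k ∈ Finset.range n, (1 - q ^ (2 * k + 1))) * ∏ k ∈ Finset.range n, (1 - q ^ (2 * (k + 1))) =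
      ∏ k ∈ Finset.range (2 * n), (1 - q ^ (k + 1)) := by
  induction n with
  | zero => simp
  | succ n ih =>
    rw [show 2 * (n + 1) = 2 * n + 1 + 1 by ring]
    simp only [Finset.prod_range_succ]
    linear_combination (1 - q ^ (2 * n + 1)) * (1 - q ^ (2 * n + 2)) * ih

theorem prod_one_add_mul_one_sub (n : ℕ) :
    (∏ k ∈ Finset.range n, (1 + q ^ (k + 1))) * ∏ k ∈ Finset.range n, (1 - q ^ (k + 1)) =
      ∏ k ∈ Finset.range n, (1 - q ^ (2 * (k + 1))) := by
  rw [← Finset.prod_mul_distrib]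
  exact Finset.prod_congr rfl fun k _ ↦ by ring

end Finite

/-! ### Limits of power series -/

theorem tendsto_zero_of_X_pow_dvd {f : ℕ → ℤ⟦X⟧} (h : ∀ n, X ^ n ∣ f n) :
    Tendsto f atTop (𝓝 0) := by
  rw [WithPiTopology.tendsto_iff_coeff_tendsto]
  intro d
  refine tendsto_const_nhds.congr' ?_
  filter_upwards [eventually_gt_atTop d] with n hn
  rw [map_zero, X_pow_dvd_iff.mp (h n) d hn]

theorem tendsto_of_X_pow_dvd_sub {f : ℕ → ℤ⟦X⟧} {g : ℤ⟦X⟧} (h : ∀ n, X ^ n ∣ f n - g) :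
    Tendsto f atTop (𝓝 g) := by
  simpa using (tendsto_zero_of_X_pow_dvd h).add_const g

theorem tendsto_etaProd {d : ℕ} (hd : 1 ≤ d) :
    Tendsto (fun n ↦ ∏ k ∈ Finset.range n, (1 - (X : ℤ⟦X⟧) ^ (d * (k + 1)))) atTop
      (𝓝 (etaProd d)) :=
  (multipliable_etaProd hd).hasProd.tendsto_prod_nat

theorem tendsto_etaProd_one :
    Tendsto (fun n ↦ ∏ k ∈ Finset.range n, (1 - (X : ℤ⟦X⟧) ^ (k + 1))) atTop
      (𝓝 (etaProd 1)) := by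
  simpa using tendsto_etaProd le_rfl

theorem tendsto_two_mul : Tendsto (fun n : ℕ ↦ 2 * n) atTop atTop :=
  tendsto_id.const_mul_atTop' two_pos

theorem continuous_evalNegHom : Continuous (evalNegHom : ℤ⟦X⟧ → ℤ⟦X⟧) := by
  rw [continuous_iff_continuousAt]
  intro f
  rw [ContinuousAt, WithPiTopology.tendsto_iff_coeff_tendsto]
  intro d
  simp only [evalNegHom, coeff_rescale]
  exact ((WithPiTopology.continuous_coeff ℤ d).tendsto f).const_mul _

theorem continuous_expand_two : Continuous (expand 2 two_ne_zero : ℤ⟦X⟧ → ℤ⟦X⟧) := by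
  rw [continuous_iff_continuousAt]
  intro f
  rw [ContinuousAt, WithPiTopology.tendsto_iff_coeff_tendsto]
  intro d
  simp only [coeff_expand]
  split_ifs with h
  · exact (WithPiTopology.continuous_coeff ℤ _).tendsto f
  · exact tendsto_const_nhds

theorem expand_etaProd {d : ℕ} (hd : 1 ≤ d) :
    expand 2 two_ne_zero (etaProd d) = etaProd (2 * d) := by
  refine tendsto_nhds_unique ((continuous_expand_two.tendsto _).comp (tendsto_etaProd hd))
    ((tendsto_etaProd (by omega : 1 ≤ 2 * d)).congr fun n ↦ ?_)
  simp [← pow_mul, mul_assoc]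

theorem evalNegHom_etaProd_even (d : ℕ) (hd : 1 ≤ d) :
    evalNegHom (etaProd (2 * d)) = etaProd (2 * d) := by
  have hd' : 1 ≤ 2 * d := by omega
  refine tendsto_nhds_unique ((continuous_evalNegHom.tendsto _).comp (tendsto_etaProd hd'))
    ((tendsto_etaProd hd').congr fun n ↦ ?_)
  simp only [Function.comp_apply, map_prod, map_sub, map_one, map_pow, evalNegHom_X, mul_assoc]
  simp [pow_mul]

/-- `∏ (1 - qⁿ) (1 - (-q)ⁿ) (1 - q⁴ⁿ) = ∏ (1 - q²ⁿ)³`. -/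
theorem etaProd_one_mul_evalNegHom :
    etaProd 1 * evalNegHom (etaProd 1) * etaProd 4 = etaProd 2 ^ 3 := by
  have h2 := tendsto_etaProd_one.comp tendsto_two_mul
  have h := (h2.mul ((continuous_evalNegHom.tendsto _).comp h2)).mul
    (tendsto_etaProd (d := 4) (by norm_num))
  have h' := ((tendsto_etaProd (d := 2) (by norm_num)).pow 2).mul
    ((tendsto_etaProd (d := 2) (by norm_num)).comp tendsto_two_mul)
  refine (tendsto_nhds_unique h (h'.congr fun n ↦ ?_)).trans (pow_succ _ 2).symm
  have := prod_one_sub_mul_prod_one_sub_neg (X : ℤ⟦X⟧) n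
  simp only [Function.comp_apply, map_prod, map_sub, map_one, map_pow, evalNegHom_X]
  exact this.symm

/-! ### The theta series -/

/-- `∑_{n ∈ ℤ} q ^ n²`. -/
def thetaSq : ℤ⟦X⟧ :=
  mk fun n ↦ if n = 0 then 1 else if IsSquare n then 2 else 0

/-- `∑_{n ≥ 0} q ^ (n (n + 1) / 2)`. -/
def thetaTri : ℤ⟦X⟧ :=
  mk fun n ↦ if IsSquare (8 * n + 1) then 1 else 0

/-- Even squares are 4 times a square; odd squares are 8 times a triangular number plus 1. -/
theorem thetaSq_eq_expand :
    thetaSq = expand 4 four_ne_zero thetaSq + 2 * X * expand 8 (by norm_num) thetaTri := by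
  ext n
  have h2 : (2 : ℤ⟦X⟧) = C 2 := rfl
  rw [map_add, mul_assoc, h2, coeff_C_mul, coeff_expand]
  have sq4 (m : ℕ) : IsSquare (4 * m) ↔ IsSquare m := by
    constructor
    · rintro ⟨r, hr⟩
      obtain ⟨k, rfl | rfl⟩ := Nat.even_or_odd' r
      · exact ⟨k, by nlinarith⟩
      · ring_nf at hr; omega
    · rintro ⟨r, rfl⟩; exact ⟨2 * r, by ring⟩
  rcases n with _ | n
  · simp [thetaSq]
  rw [coeff_succ_X_mul, coeff_expand]
  by_cases h4 : 4 ∣ n + 1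
  · have h8 : ¬ 8 ∣ n := by omega
    obtain ⟨m, hm⟩ := h4
    have hm0 : m ≠ 0 := by omega
    simp [h8, hm, thetaSq, hm0, sq4]
  · rw [if_neg h4]
    by_cases h8 : 8 ∣ n
    · obtain ⟨m, rfl⟩ := h8
      simp [thetaSq, thetaTri]
    · have : ¬ IsSquare (n + 1) := by
        rintro ⟨r, hr⟩
        obtain ⟨k, rfl | rfl⟩ := Nat.even_or_odd' r
        · exact h4 ⟨k * k, by nlinarith⟩
        · obtain ⟨c, hc⟩ := (Nat.even_mul_succ_self k).two_dvd
          exact h8 ⟨c, by nlinarith⟩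
      simp [h8, thetaSq, this]

theorem tendsto_thetaSq :
    Tendsto (fun n ↦ 1 + 2 * ∑ s ∈ Finset.range n, (-1) ^ (s + 1) * (X : ℤ⟦X⟧) ^ (s + 1) ^ 2) atTop
      (𝓝 (evalNegHom thetaSq)) := by
  refine tendsto_of_X_pow_dvd_sub fun n ↦ X_pow_dvd_iff.mpr fun m hm ↦ ?_
  rw [map_sub, sub_eq_zero, map_add, show (2 : ℤ⟦X⟧) = C 2 from rfl, coeff_C_mul, map_sum]
  have hc (s : ℕ) : coeff m ((-1) ^ (s + 1) * (X : ℤ⟦X⟧) ^ (s + 1) ^ 2) =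
      if m = (s + 1) ^ 2 then (-1) ^ (s + 1) else 0 := by
    rw [show ((-1 : ℤ⟦X⟧)) = C (-1) by simp, ← map_pow, coeff_C_mul, coeff_X_pow]
    simp
  simp only [hc, evalNegHom, coeff_rescale, thetaSq, coeff_mk, coeff_one]
  by_cases hm0 : m = 0
  · subst hm0
    rw [Finset.sum_eq_zero fun s _ ↦ if_neg (by positivity)]
    simp
  by_cases hs : IsSquare m
  · obtain ⟨r, rfl⟩ := hs
    have hr0 : r ≠ 0 := by rintro rfl; simp at hm0
    rw [Finset.sum_eq_single (r - 1)]
    · have h1 : r - 1 + 1 = r := by omega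
      have h3 : ((-1 : ℤ)) ^ (r * r) = (-1) ^ r := by
        rw [pow_mul]
        rcases Nat.even_or_odd r with h | h
        · simp [h.neg_one_pow]
        · simp [h.neg_one_pow]
      simp [h1, hm0, h3, sq, mul_comm]
    · intro s _ hs
      rw [if_neg]
      intro h
      rw [← sq, pow_left_inj₀ (by omega) (by omega) two_ne_zero] at h
      omega
    · intro h
      rw [Finset.mem_range] at h
      have := Nat.le_mul_self r
      omega
  · rw [Finset.sum_eq_zero]
    · simp [hm0, hs]
    · intro s _
      rw [if_neg]
      rintro rfl
      exact hs ⟨s + 1, by ring⟩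

theorem tendsto_thetaTri :
    Tendsto (fun n ↦ ∑ s ∈ Finset.range n, (X : ℤ⟦X⟧) ^ (s * (s + 1) / 2)) atTop
      (𝓝 thetaTri) := by
  refine tendsto_of_X_pow_dvd_sub fun n ↦ X_pow_dvd_iff.mpr fun m hm ↦ ?_
  rw [map_sub, sub_eq_zero, map_sum]
  simp only [coeff_X_pow, thetaTri, coeff_mk]
  have htri (s : ℕ) : 8 * (s * (s + 1) / 2) + 1 = (2 * s + 1) ^ 2 := by
    have := Nat.div_mul_cancel (Nat.even_mul_succ_self s).two_dvd
    nlinarith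
  by_cases hs : IsSquare (8 * m + 1)
  · obtain ⟨r, hr⟩ := hs
    obtain ⟨k, rfl | rfl⟩ := Nat.even_or_odd' r
    · ring_nf at hr; omega
    have hk : m = k * (k + 1) / 2 := by
      have := htri k
      nlinarith
    rw [Finset.sum_eq_single k]
    · rw [if_pos hk, if_pos ⟨_, hr⟩]
    · intro s _ hsk
      rw [if_neg]
      intro h
      have h1 := htri s
      rw [← h, hr, ← sq, pow_left_inj₀ (by omega) (by omega) two_ne_zero] at h1
      omega
    · intro h
      rw [Finset.mem_range] at h
      have := htri k
      nlinarith
  · rw [Finset.sum_eq_zero]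
    · simp [hs]
    · intro s _
      rw [if_neg]
      rintro rfl
      exact hs ⟨2 * s + 1, by rw [htri]; ring⟩

/-- Gauss: `∑ (-1)ⁿ q ^ n² = η(τ)² / η(2τ)`. -/
theorem evalNegHom_thetaSq_mul_etaProd :
    evalNegHom thetaSq * etaProd 2 = etaProd 1 ^ 2 := by
  have h1 := tendsto_thetaSq.mul (tendsto_etaProd (d := 2) (by norm_num))
  have h0 : Tendsto (fun n ↦ 2 * ∑ s ∈ Finset.range n, squareTerm (X : ℤ⟦X⟧) n s) atTop (𝓝 0) := by
    refine tendsto_zero_of_X_pow_dvd fun n ↦ Dvd.dvd.mul_left (Finset.dvd_sum fun s _ ↦ ?_) _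
    refine Dvd.dvd.mul_right (Dvd.dvd.mul_right (Dvd.dvd.mul_left (pow_dvd_pow _ ?_) _) _) _
    nlinarith
  have h2 := (tendsto_etaProd_one.add h0).mul tendsto_etaProd_one
  rw [add_zero, ← sq] at h2
  refine tendsto_nhds_unique h1 (h2.congr fun n ↦ ?_)
  rw [← prod_mul_sum_neg_one_pow_sq, ← prod_one_add_mul_one_sub]
  ring

/-- Gauss: `∑ q ^ (n (n + 1) / 2) = q ^ (-1 / 8) η(2τ)² / η(τ)`. -/
theorem thetaTri_mul_etaProd : thetaTri * etaProd 1 = etaProd 2 ^ 2 := by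
  have h1 := (tendsto_thetaTri.comp ((tendsto_add_atTop_nat 1).comp tendsto_two_mul)).mul
    (tendsto_etaProd_one.comp tendsto_two_mul)
  have h0 : Tendsto (fun n ↦ ∑ s ∈ Finset.range n, triangleTerm (X : ℤ⟦X⟧) n (s + 1)) atTop
      (𝓝 0) := by
    refine tendsto_zero_of_X_pow_dvd fun n ↦ Finset.dvd_sum fun s _ ↦ ?_
    refine Dvd.dvd.mul_right (Dvd.dvd.mul_right (pow_dvd_pow _ ?_) _) _
    nlinarith
  have he := tendsto_etaProd (d := 2) (by norm_num)
  have h2 := (h0.add he).mul he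
  rw [zero_add, ← sq] at h2
  refine tendsto_nhds_unique h1 (h2.congr fun n ↦ ?_)
  have h3 := prod_mul_sum_triangle (X : ℤ⟦X⟧) n
  rw [Finset.sum_range_succ' _ n] at h3
  have h4 : triangleTerm (X : ℤ⟦X⟧) n 0 = ∏ k ∈ Finset.range n, (1 - X ^ (2 * (k + 1))) := by
    simp [triangleTerm, mul_add]
  rw [← h4, ← h3, h4]
  simp only [Function.comp_apply]
  rw [← prod_one_sub_odd_mul_even]
  ring

/-! ### The operator `U₂` -/

/-- The substitution `q ↦ q²`. -/
noncomputable abbrev dbl : ℤ⟦X⟧ →ₐ[ℤ] ℤ⟦X⟧ := expand 2 two_ne_zero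

theorem U2_add (f g : ℤ⟦X⟧) : U2 (f + g) = U2 f + U2 g := by
  ext n; simp [U2]

theorem U2_C_mul (c : ℤ) (f : ℤ⟦X⟧) : U2 (C c * f) = C c * U2 f := by
  ext n; simp only [U2, coeff_mk, coeff_C_mul]

theorem U2_dbl (f : ℤ⟦X⟧) : U2 (dbl f) = f := by
  ext n; simp [U2, coeff_expand_mul]

theorem U2_X_mul_dbl (f : ℤ⟦X⟧) : U2 (X * dbl f) = 0 := by
  ext n
  rw [U2, coeff_mk, map_zero]
  rcases n with _ | n
  · simp
  · rw [show 2 * (n + 1) = 2 * n + 1 + 1 by ring, coeff_succ_X_mul, coeff_expand_of_not_dvd]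
    omega

theorem exists_eq_dbl_U2_add (f : ℤ⟦X⟧) : ∃ g, f = dbl (U2 f) + X * dbl g := by
  refine ⟨mk fun n ↦ coeff (2 * n + 1) f, ?_⟩
  ext n
  obtain ⟨k, rfl | rfl⟩ := Nat.even_or_odd' n
  · rw [map_add, coeff_expand_mul]
    rcases k with _ | k
    · simp [U2]
    · rw [show 2 * (k + 1) = 2 * k + 1 + 1 by ring, coeff_succ_X_mul, coeff_expand_of_not_dvd]
      · simp [U2]; ring_nf
      · omega
  · rw [map_add, coeff_succ_X_mul, coeff_expand_mul, coeff_expand_of_not_dvd]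
    · simp
    · omega

theorem U2_dbl_mul (f g : ℤ⟦X⟧) : U2 (dbl f * g) = f * U2 g := by
  obtain ⟨h, hh⟩ := exists_eq_dbl_U2_add g
  rw [hh, U2_add, U2_dbl, U2_X_mul_dbl, add_zero, mul_add, mul_left_comm, U2_add, ← map_mul,
    ← map_mul, U2_dbl, U2_X_mul_dbl, add_zero]

theorem constantCoeff_U2 (f : ℤ⟦X⟧) : constantCoeff (U2 f) = constantCoeff f := by
  rw [← coeff_zero_eq_constantCoeff_apply, ← coeff_zero_eq_constantCoeff_apply, U2, coeff_mk,
    mul_zero]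

/-! ### Substitution, rescaling and `U2`. -/

theorem dbl_subst {a : ℤ⟦X⟧} (ha : HasSubst a) (f : ℤ⟦X⟧) :
    dbl (f.subst a) = f.subst (dbl a) := expand_subst _ _ ha f

/-- If `v` is odd and `v²` is `w(q²)`, then `U₂` acts on series in `v` through the argument. -/
theorem U2_subst {u w : ℤ⟦X⟧} (hw : constantCoeff w = 0) (h : (X * dbl u) ^ 2 = dbl w)
    (f : ℤ⟦X⟧) : U2 (f.subst (X * dbl u)) = (U2 f).subst w := by
  have hv : HasSubst (X * dbl u) := .of_constantCoeff_zero' (by simp)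
  have hw : HasSubst w := .of_constantCoeff_zero' hw
  have key (k : ℤ⟦X⟧) : (dbl k).subst (X * dbl u) = dbl (k.subst w) := by
    rw [dbl_subst hw, ← h, expand_apply 2 two_ne_zero k, subst_comp_subst_apply (.X_pow two_ne_zero) hv,
      subst_pow hv, subst_X hv]
  -- The even part of `f` becomes a series in `q²`; the odd part becomes `v` times such a series,
  -- hence odd in `q` and killed by `U2`.
  obtain ⟨g, hg⟩ := exists_eq_dbl_U2_add f
  conv_lhs => rw [hg]
  rw [subst_add hv, subst_mul hv, key, key, subst_X hv, mul_assoc, ← map_mul, U2_add, U2_dbl,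
    U2_X_mul_dbl, add_zero]

theorem U2_rescale (c : ℤ) (f : ℤ⟦X⟧) : U2 (rescale c f) = rescale (c ^ 2) (U2 f) := by
  ext n; simp [U2, coeff_rescale, pow_mul]

theorem subst_C_mul {c : ℤ} {a : ℤ⟦X⟧} (ha : constantCoeff a = 0) (f : ℤ⟦X⟧) :
    f.subst (C c * a) = (rescale c f).subst a := by
  have ha : HasSubst a := .of_constantCoeff_zero' ha
  rw [rescale_eq_subst, subst_comp_subst_apply (HasSubst.smul_X' c) ha, subst_smul ha, subst_X ha,
    smul_eq_C_mul]

theorem U2_subst_C_mul {u w : ℤ⟦X⟧} (hw : constantCoeff w = 0) (h : (X * dbl u) ^ 2 = dbl w)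
    (c : ℤ) (f : ℤ⟦X⟧) :
    U2 (f.subst (C c * (X * dbl u))) = (U2 f).subst (C (c ^ 2) * w) := by
  rw [subst_C_mul (by simp), U2_subst hw h, U2_rescale, ← subst_C_mul hw]

/-- The `n`-th coefficient is scaled by `c ^ n`, and only `n ≥ 1` occurs. This is the source of
every factor 2 gained. -/
theorem exists_rescale_eq {f : ℤ⟦X⟧} (hf : constantCoeff f = 0) (c : ℤ) :
    ∃ g : ℤ⟦X⟧, constantCoeff g = 0 ∧ rescale c f = C c * g := by
  obtain ⟨g, rfl⟩ := X_dvd_iff.mpr hf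
  exact ⟨X * rescale c g, by simp, by rw [map_mul, rescale_X, mul_assoc]⟩

theorem C_mul_subst {c : ℤ} {a : ℤ⟦X⟧} (ha : HasSubst a) (f : ℤ⟦X⟧) :
    (C c * f).subst a = C c * f.subst a := by
  rw [← smul_eq_C_mul, subst_smul ha, smul_eq_C_mul]

theorem exists_subst_C_mul_eq {f a : ℤ⟦X⟧} (hf : constantCoeff f = 0) (ha : constantCoeff a = 0)
    (c : ℤ) : ∃ g, f.subst (C c * a) = C c * g := by
  obtain ⟨g, -, hg⟩ := exists_rescale_eq hf c
  have ha' : HasSubst a := .of_constantCoeff_zero' ha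
  exact ⟨g.subst a, by rw [subst_C_mul ha, hg, C_mul_subst ha']⟩

/-! ### Relations between theta series and eta products -/

theorem etaProd_ne_zero {d : ℕ} (hd : 1 ≤ d) : etaProd d ≠ 0 := fun h ↦ by
  simpa [h] using constantCoeff_etaProd hd

theorem expand_congr {a b : ℕ} {ha : a ≠ 0} {hb : b ≠ 0} (h : a = b) (f : ℤ⟦X⟧) :
    expand a ha f = expand b hb f := by
  subst h; rfl

theorem dbl_dbl (f : ℤ⟦X⟧) : dbl (dbl f) = expand 4 four_ne_zero f :=
  (expand_mul 2 two_ne_zero 2 two_ne_zero f).symm.trans (expand_congr rfl _)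

theorem dbl_dbl_dbl (f : ℤ⟦X⟧) : dbl (dbl (dbl f)) = expand 8 (by norm_num) f := by
  have h := expand_mul 4 four_ne_zero 2 two_ne_zero f
  rw [dbl_dbl, ← h]

theorem thetaSq_eq :
    thetaSq = dbl (dbl thetaSq) + 2 * X * dbl (dbl (dbl thetaTri)) := by
  rw [dbl_dbl_dbl, dbl_dbl]
  exact thetaSq_eq_expand

theorem evalNegHom_dbl (f : ℤ⟦X⟧) : evalNegHom (dbl f) = dbl f := by
  ext n
  simp only [evalNegHom, coeff_rescale, coeff_expand]
  split_ifs with h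
  · rw [(even_iff_two_dvd.mpr h).neg_one_pow, one_mul]
  · simp

theorem evalNegHom_evalNegHom (f : ℤ⟦X⟧) : evalNegHom (evalNegHom f) = f := by
  simp [evalNegHom, rescale_rescale]

theorem evalNegHom_thetaSq :
    evalNegHom thetaSq = dbl (dbl thetaSq) - 2 * X * dbl (dbl (dbl thetaTri)) := by
  conv_lhs => rw [thetaSq_eq]
  simp only [map_add, map_mul, evalNegHom_dbl, evalNegHom_X, map_ofNat]
  ring

theorem dbl_etaProd_one : dbl (etaProd 1) = etaProd 2 := expand_etaProd le_rfl

theorem dbl_etaProd_two : dbl (etaProd 2) = etaProd 4 := expand_etaProd (by norm_num)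

theorem evalNegHom_etaProd_two : evalNegHom (etaProd 2) = etaProd 2 :=
  evalNegHom_etaProd_even 1 le_rfl

theorem thetaSq_mul_etaProd : thetaSq * etaProd 2 = evalNegHom (etaProd 1) ^ 2 := by
  have := congrArg evalNegHom evalNegHom_thetaSq_mul_etaProd
  rwa [map_mul, map_pow, evalNegHom_evalNegHom, evalNegHom_etaProd_two] at this

theorem thetaSq_mul_evalNegHom_thetaSq :
    thetaSq * evalNegHom thetaSq = dbl (evalNegHom thetaSq) ^ 2 := by
  have h1 := congrArg dbl evalNegHom_thetaSq_mul_etaProd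
  rw [map_mul, map_pow, dbl_etaProd_one, dbl_etaProd_two] at h1
  have h2 := thetaSq_mul_etaProd
  have h3 := evalNegHom_thetaSq_mul_etaProd
  have h4 := etaProd_one_mul_evalNegHom
  have hne : etaProd 2 ^ 2 * etaProd 4 ^ 2 ≠ 0 := mul_ne_zero
    (pow_ne_zero _ (etaProd_ne_zero (by norm_num))) (pow_ne_zero _ (etaProd_ne_zero (by norm_num)))
  refine mul_right_cancel₀ hne ?_
  linear_combination etaProd 4 ^ 2 * evalNegHom thetaSq * etaProd 2 * h2
    + etaProd 4 ^ 2 * evalNegHom (etaProd 1) ^ 2 * h3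
    + (etaProd 1 * evalNegHom (etaProd 1) * etaProd 4 + etaProd 2 ^ 3) * h4
    - etaProd 2 ^ 2 * (dbl (evalNegHom thetaSq) * etaProd 4 + etaProd 2 ^ 2) * h1

/-- `φ(q)² = φ(q²)² + 4 q ψ(q⁴)²`, after `q ↦ q²`. -/
theorem dbl_thetaSq_sq : dbl thetaSq ^ 2 =
    dbl (dbl thetaSq) ^ 2 + 4 * X ^ 2 * dbl (dbl (dbl thetaTri)) ^ 2 := by
  have h1 := thetaSq_mul_evalNegHom_thetaSq
  conv_lhs at h1 => rw [evalNegHom_thetaSq]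
  conv_lhs at h1 => enter [1]; rw [thetaSq_eq]
  have h2 : thetaSq ^ 2 = dbl thetaSq ^ 2 + 4 * X * dbl (dbl thetaTri) ^ 2 := by
    -- Both sides of the product formula for φ(q)φ(-q) are series in `q²`: pass back to `q`, then
    -- replace `q` by `-q`.
    have inj : Function.Injective dbl := fun a b h ↦ by rw [← U2_dbl a, h, U2_dbl]
    have h3 : dbl (evalNegHom thetaSq ^ 2) =
        dbl (dbl thetaSq ^ 2 - 4 * X * dbl (dbl thetaTri) ^ 2) := by
      simp only [map_sub, map_mul, map_pow, expand_X, map_ofNat]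
      rw [← h1]
      ring
    have h4 := congrArg evalNegHom (inj h3)
    simp only [map_sub, map_mul, map_pow, evalNegHom_evalNegHom, evalNegHom_dbl, evalNegHom_X,
      map_ofNat] at h4
    rw [h4]
    ring
  have h3 := congrArg dbl h2
  simp only [map_add, map_mul, map_pow, expand_X, map_ofNat] at h3
  exact h3

theorem thetaTri_sq : thetaTri ^ 2 = thetaSq * dbl thetaTri := by
  have h1 := thetaTri_mul_etaProd
  have h2 := congrArg dbl h1
  rw [map_mul, map_pow, dbl_etaProd_one, dbl_etaProd_two] at h2
  have h3 := thetaSq_mul_etaProd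
  have h4 := etaProd_one_mul_evalNegHom
  have hne : etaProd 1 ^ 2 * etaProd 2 ^ 2 ≠ 0 := mul_ne_zero
    (pow_ne_zero _ (etaProd_ne_zero (by norm_num))) (pow_ne_zero _ (etaProd_ne_zero (by norm_num)))
  refine mul_right_cancel₀ hne ?_
  linear_combination etaProd 2 ^ 2 * (thetaTri * etaProd 1 + etaProd 2 ^ 2) * h1
    - etaProd 1 ^ 2 * thetaSq * etaProd 2 * h2
    - etaProd 1 ^ 2 * etaProd 4 ^ 2 * h3
    - (etaProd 1 * evalNegHom (etaProd 1) * etaProd 4 + etaProd 2 ^ 3) * h4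

/-- Two applications of ψ(q)² = φ(q)ψ(q²), at `q²` and at `q⁴`. -/
theorem dbl_thetaTri_pow_four : dbl thetaTri ^ 4 =
    dbl (dbl (dbl thetaTri)) * dbl (dbl thetaSq) * dbl thetaSq ^ 2 := by
  have h1 := congrArg dbl thetaTri_sq
  have h2 := congrArg dbl h1
  simp only [map_mul, map_pow] at h1 h2
  linear_combination (dbl thetaTri ^ 2 + dbl thetaSq * dbl (dbl thetaTri)) * h1
    + dbl thetaSq ^ 2 * h2

/-- `1 / φ(q)`. -/
noncomputable abbrev recipTheta : ℤ⟦X⟧ := evalNegHom Phi2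

theorem evalNegHom_thetaSq_mul_Phi2 : evalNegHom thetaSq * Phi2 = 1 := by
  have h := etaProd_mul_etaProdInv (d := 1) le_rfl
  rw [Phi2]
  linear_combination etaProdInv 1 ^ 2 * evalNegHom_thetaSq_mul_etaProd
    + (etaProd 1 * etaProdInv 1 + 1) * h

theorem thetaSq_mul_recipTheta : thetaSq * recipTheta = 1 := by
  simpa [evalNegHom_evalNegHom] using congrArg evalNegHom evalNegHom_thetaSq_mul_Phi2

theorem etaProd_two_mul_inv_pow_eight :
    (etaProd 2 * etaProdInv 1) ^ 24 = thetaTri ^ 8 * Phi2 ^ 8 := by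
  have h := etaProd_mul_etaProdInv (d := 1) le_rfl
  have h1 : thetaTri = etaProd 2 ^ 2 * etaProdInv 1 := by
    linear_combination etaProdInv 1 * thetaTri_mul_etaProd - thetaTri * h
  rw [h1, Phi2]
  ring

/-! ### Uniformizers -/

/-- `q ψ(q²)⁴ / φ(q)⁴`. -/
noncomputable def tParam : ℤ⟦X⟧ := X * (dbl thetaTri) ^ 4 * recipTheta ^ 4

/-- `ψ(q²)² / φ(q)²`. -/
noncomputable def wRoot : ℤ⟦X⟧ := (dbl thetaTri) ^ 2 * recipTheta ^ 2

/-- `ψ(q⁴) / φ(q²)`. -/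
noncomputable def vRoot : ℤ⟦X⟧ := dbl (dbl thetaTri) * dbl recipTheta

theorem constantCoeff_tParam : constantCoeff tParam = 0 := by simp [tParam]

theorem sq_X_mul_dbl_wRoot : (X * dbl wRoot) ^ 2 = dbl tParam := by
  simp only [wRoot, tParam, map_mul, map_pow, expand_X]
  ring

theorem sq_X_mul_dbl_vRoot : (X * dbl vRoot) ^ 2 = dbl (X * dbl wRoot) := by
  simp only [wRoot, vRoot, map_mul, map_pow, expand_X]
  ring

theorem dbl_dbl_thetaSq_mul_recipTheta :
    dbl (dbl thetaSq) * dbl (dbl recipTheta) = 1 := by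
  rw [← map_mul, ← map_mul, thetaSq_mul_recipTheta, map_one, map_one]

theorem one_add_two_mul_v :
    1 + 2 * (X * dbl vRoot) = thetaSq * dbl (dbl recipTheta) := by
  have h := dbl_dbl_thetaSq_mul_recipTheta
  nth_rw 1 [thetaSq_eq]
  simp only [vRoot, map_mul]
  linear_combination -h

theorem one_sub_two_mul_v :
    1 - 2 * (X * dbl vRoot) = evalNegHom thetaSq * dbl (dbl recipTheta) := by
  have h := dbl_dbl_thetaSq_mul_recipTheta
  rw [evalNegHom_thetaSq]
  simp only [vRoot, map_mul]
  linear_combination -h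

theorem recipTheta_mul_one_add :
    recipTheta * (1 + 2 * (X * dbl vRoot)) = dbl (dbl recipTheta) := by
  rw [one_add_two_mul_v]
  linear_combination dbl (dbl recipTheta) * thetaSq_mul_recipTheta

theorem tParam_mul :
    tParam * (1 + 2 * (X * dbl vRoot)) ^ 4 =
      X * dbl vRoot * (1 + 4 * (X * dbl vRoot) ^ 2) := by
  have h := dbl_dbl_thetaSq_mul_recipTheta
  have h1 := recipTheta_mul_one_add
  have h2 : tParam * (1 + 2 * (X * dbl vRoot)) ^ 4 =
      X * (dbl thetaTri) ^ 4 * dbl (dbl recipTheta) ^ 4 := by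
    rw [tParam, ← h1]; ring
  rw [h2, dbl_thetaTri_pow_four, dbl_thetaSq_sq]
  simp only [vRoot, map_mul]
  generalize dbl (dbl (dbl thetaTri)) = a, dbl (dbl recipTheta) = b,
    dbl (dbl thetaSq) = c at *
  have e : c ^ 3 * b ^ 3 = 1 := by rw [← mul_pow, h, one_pow]
  linear_combination X * a * b * e + 4 * X ^ 3 * a ^ 3 * b ^ 3 * h

/-- By `tParam_mul` this reduces to (1 + 2v)⁴ - 16v(1 + 4v²) = (1 - 2v)⁴, with 1 ± 2v = φ(±q)/φ(q⁴).
-/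
theorem one_sub_sixteen_mul_tParam :
    1 - 16 * tParam = evalNegHom thetaSq ^ 4 * recipTheta ^ 4 := by
  have hu : IsUnit (dbl (dbl recipTheta)) := .of_mul_eq_one_right _ dbl_dbl_thetaSq_mul_recipTheta
  have h0 : (1 + 2 * (X * dbl vRoot)) ^ 4 ≠ 0 := by
    rw [one_add_two_mul_v]
    refine pow_ne_zero _ (mul_ne_zero ?_ hu.ne_zero)
    exact left_ne_zero_of_mul_eq_one thetaSq_mul_recipTheta
  refine mul_right_cancel₀ h0 ?_
  have h1 : evalNegHom thetaSq ^ 4 * recipTheta ^ 4 * (1 + 2 * (X * dbl vRoot)) ^ 4 =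
      (1 - 2 * (X * dbl vRoot)) ^ 4 := by
    rw [one_sub_two_mul_v, mul_pow _ _ 4, ← recipTheta_mul_one_add]
    ring
  rw [h1]
  linear_combination -16 * tParam_mul

theorem evalNegHom_thetaTri_sq :
    evalNegHom thetaTri ^ 2 = evalNegHom thetaSq * dbl thetaTri := by
  rw [← map_pow, thetaTri_sq, map_mul, evalNegHom_dbl]

/-- G₂ = qψ(q)⁸/φ(-q)⁸; after `q ↦ -q`, ψ(-q)² = φ(-q)ψ(q²) splits off `tParam` and φ(-q)⁴/φ(q)⁴. -/
theorem evalNegHom_G2 : evalNegHom G2 = -(tParam * (1 - 16 * tParam)) := by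
  rw [one_sub_sixteen_mul_tParam, G2, etaProd_two_mul_inv_pow_eight, map_mul, map_mul, map_pow,
    map_pow, evalNegHom_X, show evalNegHom thetaTri ^ 8 = (evalNegHom thetaTri ^ 2) ^ 4 by ring,
    evalNegHom_thetaTri_sq, tParam]
  ring

/-! ### Action of `U₂²` -/

theorem exists_mul_one_add_X : ∃ i : ℤ⟦X⟧, (1 + X) * i = 1 :=
  ⟨invOfUnit (1 + X) 1, mul_invOfUnit _ _ (by simp)⟩

/-- A series in `2t` divided by `φ(q)` is a series in `2v` divided by `φ(q⁴)`. -/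
theorem exists_recipTheta_mul_subst {f : ℤ⟦X⟧} (hf : constantCoeff f = 0) :
    ∃ g : ℤ⟦X⟧, constantCoeff g = 0 ∧ recipTheta * f.subst (C 2 * tParam) =
      dbl (dbl recipTheta) * g.subst (C 2 * (X * dbl vRoot)) := by
  obtain ⟨i, hi⟩ := exists_mul_one_add_X
  have hv : HasSubst (C 2 * (X * dbl vRoot)) := .of_constantCoeff_zero' (by simp)
  -- Chosen so that 2t = σ(2v), by `tParam_mul`.
  set σ : ℤ⟦X⟧ := X * (1 + X ^ 2) * i ^ 4 with hσ
  have hσs : HasSubst σ := .of_constantCoeff_zero' (by simp [hσ])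
  have C2 : (C 2 : ℤ⟦X⟧) = 2 := rfl
  have hone : (1 : ℤ⟦X⟧).subst (C 2 * (X * dbl vRoot)) = (1 : ℤ⟦X⟧) := by
    rw [← coe_substAlgHom hv, map_one]
  have hi' : (1 + 2 * (X * dbl vRoot)) * i.subst (C 2 * (X * dbl vRoot)) = 1 := by
    have := congrArg (subst (C 2 * (X * dbl vRoot))) hi
    rwa [subst_mul hv, subst_add hv, subst_X hv, hone] at this
  have hσv : σ.subst (C 2 * (X * dbl vRoot)) = C 2 * tParam := by
    rw [hσ, subst_mul hv, subst_mul hv, subst_add hv, subst_pow hv, subst_pow hv, subst_X hv, hone]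
    generalize i.subst (C 2 * (X * dbl vRoot)) = j at *
    rw [C2]
    have h4 : (1 + 2 * (X * dbl vRoot)) ^ 4 * j ^ 4 = 1 := by rw [← mul_pow, hi', one_pow]
    linear_combination 2 * tParam * h4 - 2 * j ^ 4 * tParam_mul
  -- The extra factor `i` accounts for φ(q) = (1 + 2v)φ(q⁴).
  refine ⟨f.subst σ * i, ?_, ?_⟩
  · rw [map_mul]
    have : constantCoeff (f.subst σ) = 0 :=
      constantCoeff_subst_eq_zero (show constantCoeff σ = 0 by simp [hσ]) f hf
    rw [this, zero_mul]
  · rw [subst_mul hv, subst_comp_subst_apply hσs hv, hσv, ← recipTheta_mul_one_add]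
    linear_combination -recipTheta * f.subst (C 2 * tParam) * hi'

theorem exists_U2_recipTheta_mul_subst {f : ℤ⟦X⟧} (hf : constantCoeff f = 0) :
    ∃ g : ℤ⟦X⟧, constantCoeff g = 0 ∧ U2 (recipTheta * f.subst (C 2 * tParam)) =
      dbl recipTheta * g.subst (C 4 * (X * dbl wRoot)) := by
  obtain ⟨g, hg, h⟩ := exists_recipTheta_mul_subst hf
  refine ⟨U2 g, by rw [constantCoeff_U2, hg], ?_⟩
  rw [h, U2_dbl_mul, U2_subst_C_mul (by simp) sq_X_mul_dbl_vRoot]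
  rfl

/-- `U2` squares the scale 4 to 16 = 8 · 2, and the vanishing constant term lets the 8 be pulled
out. -/
theorem exists_U2_dbl_recipTheta_mul_subst {g : ℤ⟦X⟧} (hg : constantCoeff g = 0) :
    ∃ f : ℤ⟦X⟧, constantCoeff f = 0 ∧ U2 (dbl recipTheta * g.subst (C 4 * (X * dbl wRoot))) =
      C 8 * (recipTheta * f.subst (C 2 * tParam)) := by
  obtain ⟨f, hf, h⟩ := exists_rescale_eq ((constantCoeff_U2 g).trans hg) 8
  refine ⟨f, hf, ?_⟩
  have hs : HasSubst (C 2 * tParam) := .of_constantCoeff_zero' (by simp [constantCoeff_tParam])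
  rw [U2_dbl_mul, U2_subst_C_mul constantCoeff_tParam sq_X_mul_dbl_wRoot,
    show (C (4 ^ 2) : ℤ⟦X⟧) * tParam = C 8 * (C 2 * tParam) by rw [← mul_assoc, ← map_mul]; rfl,
    subst_C_mul (by simp [constantCoeff_tParam]), h,
    C_mul_subst hs]
  ring

theorem exists_C_mul_L_zero {s : ℕ} (hs : 1 ≤ s) :
    ∃ f : ℤ⟦X⟧, constantCoeff f = 0 ∧ C (2 ^ s) * L s 0 = recipTheta * f.subst (C 2 * tParam) := by
  -- With x = 2t, 2G₂(-q) = -x(1 - 8x); this is why `2 ^ s` is needed, and `s ≥ 1` makes the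
  -- constant term vanish.
  refine ⟨(-(X * (1 - 8 * X))) ^ s, by simp [Nat.one_le_iff_ne_zero.mp hs], ?_⟩
  have ht : HasSubst (C 2 * tParam) := .of_constantCoeff_zero' (by simp [constantCoeff_tParam])
  have hX : substAlgHom ht (X : ℤ⟦X⟧) = C 2 * tParam := substAlgHom_X ht
  rw [← coe_substAlgHom ht]
  simp only [map_pow, map_neg, map_mul, map_sub, map_one, map_ofNat, L, evalNegHom_G2]
  erw [hX]
  rw [mul_left_comm, ← mul_pow, show (C 2 : ℤ⟦X⟧) = 2 from rfl]
  congr 2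
  ring

theorem exists_C_mul_L_two_mul {s : ℕ} (hs : 1 ≤ s) (α : ℕ) :
    ∃ f : ℤ⟦X⟧, constantCoeff f = 0 ∧
      C (2 ^ s) * L s (2 * α) = C (2 ^ (3 * α)) * (recipTheta * f.subst (C 2 * tParam)) := by
  induction α with
  | zero => simpa using exists_C_mul_L_zero hs
  | succ α ih =>
    obtain ⟨f, hf, h⟩ := ih
    obtain ⟨g, hg, hfg⟩ := exists_U2_recipTheta_mul_subst hf
    obtain ⟨f', hf', hgf⟩ := exists_U2_dbl_recipTheta_mul_subst hg
    refine ⟨f', hf', ?_⟩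
    have : L s (2 * (α + 1)) = U2 (U2 (L s (2 * α))) := rfl
    rw [this, ← U2_C_mul, ← U2_C_mul, h, U2_C_mul, U2_C_mul, hfg, hgf, ← mul_assoc, ← map_mul]
    congr 2
    ring

/-! ### Divisibility by powers of 2. -/

theorem exists_C_mul_L_two_mul_eq {s : ℕ} (hs : 1 ≤ s) (α : ℕ) :
    ∃ f, C (2 ^ s) * L s (2 * α) = C (2 ^ (3 * α + 1)) * f := by
  obtain ⟨f, hf, h⟩ := exists_C_mul_L_two_mul hs α
  obtain ⟨g, hg⟩ := exists_subst_C_mul_eq hf constantCoeff_tParam 2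
  refine ⟨recipTheta * g, ?_⟩
  rw [h, hg, pow_succ, map_mul]
  ring

theorem exists_C_mul_L_two_mul_add_one_eq {s : ℕ} (hs : 1 ≤ s) (α : ℕ) :
    ∃ f, C (2 ^ s) * L s (2 * α + 1) = C (2 ^ (3 * α + 2)) * f := by
  obtain ⟨f, hf, h⟩ := exists_C_mul_L_two_mul hs α
  obtain ⟨g, hg, hfg⟩ := exists_U2_recipTheta_mul_subst hf
  obtain ⟨k, hk⟩ := exists_subst_C_mul_eq hg (a := X * dbl wRoot) (by simp) 4
  refine ⟨dbl recipTheta * k, ?_⟩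
  rw [L, ← U2_C_mul, h, U2_C_mul, hfg, hk, pow_add, map_mul]
  norm_num
  ring

theorem zeroModTwoPow_of_C_mul_eq {f g : ℤ⟦X⟧} {s k : ℕ} {e : ℤ}
    (h : C (2 ^ s) * f = C (2 ^ k) * g) (he : e ≤ k - s) : ZeroModTwoPow f e := by
  intro n
  have hn := congrArg (coeff n) h
  rw [coeff_C_mul, coeff_C_mul] at hn
  have hq : (2 : ℚ) ^ s * (coeff n f : ℤ) = 2 ^ k * (coeff n g : ℤ) := by exact_mod_cast hn
  obtain ⟨d, hd⟩ := Int.eq_ofNat_of_zero_le (show 0 ≤ (k : ℤ) - s - e by omega)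
  refine ⟨2 ^ d * coeff n g, ?_⟩
  have hk : (2 : ℚ) ^ k = 2 ^ s * (2 ^ d * 2 ^ e) := by
    rw [← zpow_natCast, ← zpow_natCast, ← zpow_natCast, ← zpow_add₀ two_ne_zero,
      ← zpow_add₀ two_ne_zero]
    congr 1
    omega
  rw [hk, mul_assoc] at hq
  rw [mul_left_cancel₀ (by positivity) hq]
  push_cast
  ring

end OverpartitionU2

theorem mainTheorem9 (s α : ℕ) (hs : 1 ≤ s) (hα : 1 ≤ α) :
    OverpartitionU2.ZeroModTwoPow (OverpartitionU2.L s (2 * α - 1)) (2 * (α : ℤ) - (s : ℤ)) ∧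
    OverpartitionU2.ZeroModTwoPow (OverpartitionU2.L s (2 * α)) (2 * (α : ℤ) - (s : ℤ) + 1) := by
  obtain ⟨β, rfl⟩ := Nat.exists_eq_add_of_le' hα
  -- With `α = β + 1`, the available exponents `3β + 2 - s` and `3β + 4 - s` are at least the
  -- required `2β + 2 - s` and `2β + 3 - s`.
  constructor
  · obtain ⟨f, hf⟩ := OverpartitionU2.exists_C_mul_L_two_mul_add_one_eq hs β
    exact OverpartitionU2.zeroModTwoPow_of_C_mul_eq hf (by push_cast; omega)
  · obtain ⟨f, hf⟩ := OverpartitionU2.exists_C_mul_L_two_mul_eq hs (β + 1)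
    exact OverpartitionU2.zeroModTwoPow_of_C_mul_eq hf (by push_cast; omega)
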